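/- There is an absolute constant $C$ such that for all finite nonempty sets $\mathcal X,\mathcal Y$ and every Boolean function $f:\mathcal X\times\mathcal Y\to\{0,1\}$, \[ \mathsf{\Gamma_2 D}^{\mathsf{cc}}(f)\ \ge\ \log_2\frac{1}{\mathsf{disc}(f)}-C . \] Here the discrepancy of $f$ is \[ \mathsf{disc}(f)=\min_\mu\max_R\Bigl|\Pr_{(x,y)\sim\mu}[f(x,y)=0,\ (x,y)\in R]-\Pr_{(x,y)\sim\mu}[f(x,y)=1,\ (x,y)\in R]\Bigr|, \] where $\mu$ ranges over the probability distributions on $\mathcal X\times\mathcal Y$ and $R$ over the rectangles $A\times B$ with $A\subseteq\mathcal X$, $B\subseteq\mathcal Y$. A $\gamma_2$ protocol consists of a finite rooted ordered binary tree $\mathcal T$, in which each internal node $t$ has two children $t0,t1$ and is either an Alice node or a Bob node (nodes are denoted by the binary string leading to them from the root $\lambda$, the empty string), a dimension $d$, and vectors $\alpha_t(x),\beta_t(y)\in\mathbb R^d$ for every node $t$, $x\in\mathcal X$ and $y\in\mathcal Y$, such that the following hold for all $x,x'\in\mathcal X$ and $y,y'\in\mathcal Y$. At the root, $\langle\alpha_\lambda(x),\alpha_\lambda(x')\rangle=\langle\beta_\lambda(y),\beta_\lambda(y')\rangle=\langle\alpha_\lambda(x),\beta_\lambda(y)\rangle=1$.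 At every Alice node $t$, \[ \|\alpha_{t0}(x)\|^2+\|\alpha_{t1}(x)\|^2=\|\alpha_t(x)\|^2=\langle\alpha_{t0}(x),\alpha_t(x)\rangle+\langle\alpha_{t1}(x),\alpha_t(x)\rangle,\qquad \langle\alpha_{t0}(x),\alpha_{t1}(x)\rangle=0, \] \[ \|\beta_{ti}(y)\|^2=\|\beta_t(y)\|^2=\langle\beta_{ti}(y),\beta_t(y)\rangle\qquad(i=0,1); \] at every Bob node the same conditions hold with the roles of $\alpha$ and $\beta$ exchanged. The protocol computes $f$ if every leaf has depth at least $1$ and, for every leaf $\ell$ whose last bit is $z\in\{0,1\}$, $\langle\alpha_\ell(x),\beta_\ell(y)\rangle=0$ whenever $f(x,y)\ne z$. Finally, $\mathsf{\Gamma_2 D}^{\mathsf{cc}}(f)$ is the smallest depth of the tree $\mathcal T$ of a $\gamma_2$ protocol that computes $f$. -/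

import Mathlib

namespace GammaTwo

/-- The two players. -/
inductive Player where
  | alice
  | bob

/-- A (two-player, binary) protocol structure: a finite binary rooted ordered tree in which every
internal node has two children and belongs to exactly one of the players. -/
inductive ProtocolStructure where
  | leaf : ProtocolStructure
  | node (owner : Player) (child0 child1 : ProtocolStructure) : ProtocolStructure

namespace ProtocolStructure

/-- The depth of the tree: the largest number of edges on a path from the root to a leaf. -/
def depth : ProtocolStructure → ℕ
  | leaf => 0
  | node _ T0 T1 => max T0.depth T1.depth + 1

/-- Nodes are denoted by the binary string (`false` is `0`, `true` is `1`) leading to them from the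
root. `T.subtree t` is the subtree of `T` rooted at the node `t`, and `none` if `T` has no such
node. -/
def subtree : ProtocolStructure → List Bool → Option ProtocolStructure
  | T, [] => some T
  | leaf, _ :: _ => none
  | node _ T0 _, false :: t => T0.subtree t
  | node _ _ T1, true :: t => T1.subtree t

/-- `t` is a leaf of `T`. Its depth in `T` is the length of the string `t`. -/
def IsLeaf (T : ProtocolStructure) (t : List Bool) : Prop :=
  T.subtree t = some leaf

/-- `t` is an internal node of `T` belonging to the player `P`. -/
def IsNodeOf (T : ProtocolStructure) (P : Player) (t : List Bool) : Prop :=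
  ∃ T0 T1, T.subtree t = some (node P T0 T1)

end ProtocolStructure

/-- The constraints, at a node, on the vectors of the player who speaks there: `u` is the vector at
the node, `u0` and `u1` are the vectors at its two children. -/
def SpeakerConstraints {d : ℕ} (u u0 u1 : EuclideanSpace ℝ (Fin d)) : Prop :=
  ‖u0‖ ^ 2 + ‖u1‖ ^ 2 = ‖u‖ ^ 2 ∧
  inner ℝ u0 u + inner ℝ u1 u = ‖u‖ ^ 2 ∧
  inner ℝ u0 u1 = 0

/-- The constraints, at a node, on the vectors of the player who does not speak there. -/
def ListenerConstraints {d : ℕ} (u u0 u1 : EuclideanSpace ℝ (Fin d)) : Prop :=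
  ‖u0‖ ^ 2 = ‖u‖ ^ 2 ∧
  ‖u1‖ ^ 2 = ‖u‖ ^ 2 ∧
  inner ℝ u0 u = ‖u‖ ^ 2 ∧
  inner ℝ u1 u = ‖u‖ ^ 2

/-- A (binary, two-player) `γ₂` deterministic protocol with inputs `X × Y`. The vectors `α t x` and
`β t y` matter only if the string `t` is a node of the protocol structure; for other strings they
are unconstrained and never used. -/
structure Gamma2Protocol (X Y : Type*) where
  /-- the protocol structure -/
  T : ProtocolStructure
  /-- the dimension of the vectors -/
  d : ℕ
  /-- Alice's vectors -/
  α : List Bool → X → EuclideanSpace ℝ (Fin d)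
  /-- Bob's vectors -/
  β : List Bool → Y → EuclideanSpace ℝ (Fin d)
  root_alice : ∀ x x', inner ℝ (α [] x) (α [] x') = 1
  root_bob : ∀ y y', inner ℝ (β [] y) (β [] y') = 1
  root_both : ∀ x y, inner ℝ (α [] x) (β [] y) = 1
  alice_node : ∀ t, T.IsNodeOf Player.alice t →
    (∀ x, SpeakerConstraints (α t x) (α (t ++ [false]) x) (α (t ++ [true]) x)) ∧
    (∀ y, ListenerConstraints (β t y) (β (t ++ [false]) y) (β (t ++ [true]) y))
  bob_node : ∀ t, T.IsNodeOf Player.bob t →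
    (∀ y, SpeakerConstraints (β t y) (β (t ++ [false]) y) (β (t ++ [true]) y)) ∧
    (∀ x, ListenerConstraints (α t x) (α (t ++ [false]) x) (α (t ++ [true]) x))

/-- The protocol `π` computes the relation `f ⊆ X × Y × {0,1}ᵏ`: every leaf has depth at least `k`,
and the last `k` bits of a leaf are its output. -/
def Gamma2Protocol.Computes {X Y : Type*} (π : Gamma2Protocol X Y) {k : ℕ}
    (f : X → Y → (Fin k → Bool) → Prop) : Prop :=
  (∀ l, π.T.IsLeaf l → k ≤ l.length) ∧
  ∀ (t : List Bool) (z : Fin k → Bool), π.T.IsLeaf (t ++ List.ofFn z) →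
    ∀ x y, ¬ f x y z →
      inner ℝ (π.α (t ++ List.ofFn z) x) (π.β (t ++ List.ofFn z) y) = 0

/-- A Boolean function seen as a relation with one output bit. -/
def boolRelation {X Y : Type*} (f : X → Y → Bool) : X → Y → (Fin 1 → Bool) → Prop :=
  fun x y z => f x y = z 0

/-- The deterministic `γ₂` communication complexity of a relation: the smallest depth of a protocol
structure of a `γ₂` protocol that computes it. -/
noncomputable def gamma2Dcc {X Y : Type*} {k : ℕ} (f : X → Y → (Fin k → Bool) → Prop) : ℕ :=
  sInf {n | ∃ π : Gamma2Protocol X Y, π.Computes f ∧ π.T.depth = n}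

/-- The probability of the event `S` under the distribution `μ` on a finite set. -/
noncomputable def prob {Ω : Type*} [Fintype Ω] (μ : stdSimplex ℝ Ω) (S : Set Ω) : ℝ :=
  ∑ ω, S.indicator (μ : Ω → ℝ) ω

/-- The discrepancy of `f` on the rectangle `A × B` according to `μ`. -/
noncomputable def discRect {X Y : Type*} [Fintype X] [Fintype Y] (μ : stdSimplex ℝ (X × Y))
    (A : Set X) (B : Set Y) (f : X → Y → Bool) : ℝ :=
  |prob μ {p | f p.1 p.2 = false ∧ p ∈ A ×ˢ B} - prob μ {p | f p.1 p.2 = true ∧ p ∈ A ×ˢ B}|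

/-- The discrepancy of `f` according to `μ`: the maximum over all (finitely many) rectangles. -/
noncomputable def discUnder {X Y : Type*} [Fintype X] [Fintype Y] (μ : stdSimplex ℝ (X × Y))
    (f : X → Y → Bool) : ℝ :=
  ⨆ R : Set X × Set Y, discRect μ R.1 R.2 f

/-- The discrepancy of `f`: the minimum over all probability distributions on `X × Y`. -/
noncomputable def disc {X Y : Type*} [Fintype X] [Fintype Y] (f : X → Y → Bool) : ℝ :=
  ⨅ μ : stdSimplex ℝ (X × Y), discUnder μ f

end GammaTwo

/-! The norm and inner product conditions are equality cases: they force the speaker's vectors at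
the two children to sum to the vector at the node, and the listener's vectors to stay unchanged. So
`⟨α_t, β_t⟩` is additive over children, and the constant 1 at the root is the sum over leaves of
`⟨α_ℓ, β_ℓ⟩`, with all vectors in the unit ball.

Average this against `μ`. At a leaf with output `z` only entries with `f = z` survive, so `μ` may be
replaced by `μ` times the sign matrix of `f`, up to a global sign. Grothendieck's inequality bounds
each leaf by 384 times the cut norm of that matrix, which is the discrepancy under `μ`. At most `2 ^
depth` leaves give `1 ≤ 2 ^ depth * 384 * disc f`; then take logarithms.

Grothendieck's inequality (`grothendieckBound_of_cut`) is proved by truncating Rademacher sums and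
iterating `GrothendieckBound.improve`. -/

namespace GammaTwo

open Finset

/-! ### Grothendieck's inequality from the cut norm -/

section Grothendieck

/-- Unnormalised Rademacher vectors: a finite sample space with `d` random variables that are
orthonormal under the uniform distribution and satisfy a fourth-moment Khintchine inequality. -/
theorem exists_rademacher (d : ℕ) :
    ∃ (Ω : Type) (_ : Fintype Ω) (r : (Fin d → ℝ) → Ω → ℝ), 0 < Fintype.card Ω ∧
      (∀ u v, ∑ ω, r u ω * r v ω = Fintype.card Ω * ∑ i, u i * v i) ∧
      ∀ u, ∑ ω, r u ω ^ 4 ≤ 3 * Fintype.card Ω * (∑ i, u i ^ 2) ^ 2 := by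
  induction d with
  | zero => exact ⟨Unit, inferInstance, fun _ _ => 0, by simp, by simp, by simp⟩
  | succ d ih =>
    obtain ⟨Ω, _, r, hN, h2, h4⟩ := ih
    -- Coordinate 0 is multiplied by a fresh independent sign; terms odd in that sign cancel.
    refine ⟨Ω × Bool, inferInstance,
      fun u p => r (fun i => u i.succ) p.1 + (if p.2 then u 0 else -u 0), by simpa using hN,
      fun u v => ?_, fun u => ?_⟩
    · have h := h2 (fun i => u i.succ) (fun i => v i.succ)
      calc _ = ∑ ω, (2 * (r (fun i => u i.succ) ω * r (fun i => v i.succ) ω)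
                + 2 * (u 0 * v 0)) := by
            rw [Fintype.sum_prod_type]
            refine sum_congr rfl fun ω _ => ?_
            simp only [Fintype.sum_bool, if_true, Bool.false_eq_true, if_false]
            ring
        _ = _ := by
            rw [sum_add_distrib, ← mul_sum, h, Fin.sum_univ_succ]
            simp
            ring
    · set w : Fin d → ℝ := fun i => u i.succ with hw
      have h := h2 w w
      have h' := h4 w
      have e : ∑ i, w i * w i = ∑ i, w i ^ 2 := sum_congr rfl fun i _ => by ring
      have e' : ∑ ω, r w ω ^ 2 = ∑ ω, r w ω * r w ω := sum_congr rfl fun i _ => by ring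
      rw [e] at h
      rw [h] at e'
      calc _ = ∑ ω, (2 * r w ω ^ 4 + 12 * u 0 ^ 2 * r w ω ^ 2 + 2 * u 0 ^ 4) := by
            rw [Fintype.sum_prod_type]
            refine sum_congr rfl fun ω _ => ?_
            simp only [Fintype.sum_bool, if_true, Bool.false_eq_true, if_false]
            ring
        _ = 2 * ∑ ω, r w ω ^ 4 + 12 * u 0 ^ 2 * (Fintype.card Ω * ∑ i, w i ^ 2)
              + Fintype.card Ω * (2 * u 0 ^ 4) := by
            rw [sum_add_distrib, sum_add_distrib, ← mul_sum, ← mul_sum, e']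
            simp
        _ ≤ _ := by
            rw [Fin.sum_univ_succ]
            simp only [Fintype.card_prod, Fintype.card_bool, Nat.cast_mul, Nat.cast_ofNat]
            change _ ≤ 3 * _ * (u 0 ^ 2 + ∑ i, w i ^ 2) ^ 2
            have : 0 ≤ (Fintype.card Ω : ℝ) * u 0 ^ 4 := by positivity
            linarith

/-- The extreme case is `∑ |g|`, the sum over `{g ≥ 0}` minus the sum over its complement. -/
theorem abs_sum_mul_le_of_indicator {X : Type*} [Fintype X] {g s : X → ℝ} {D : ℝ}
    (hg : ∀ A : Set X, |∑ x, A.indicator g x| ≤ D) (hs : ∀ x, |s x| ≤ 1) :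
    |∑ x, s x * g x| ≤ 2 * D := by
  classical
  set A : Set X := {x | 0 ≤ g x} with hA
  calc |∑ x, s x * g x| ≤ ∑ x, |g x| := by
        refine (abs_sum_le_sum_abs _ _).trans (sum_le_sum fun x _ => ?_)
        rw [abs_mul]
        exact mul_le_of_le_one_left (abs_nonneg _) (hs x)
    _ = ∑ x, A.indicator g x - ∑ x, Aᶜ.indicator g x := by
        rw [← sum_sub_distrib]
        refine sum_congr rfl fun x _ => ?_
        by_cases hx : 0 ≤ g x
        · simp [hA, Set.indicator, hx, abs_of_nonneg hx]
        · simp [hA, Set.indicator, hx, abs_of_neg (not_le.1 hx)]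
    _ ≤ 2 * D := by
        have h1 := (abs_le.1 (hg A)).2
        have h2 := (abs_le.1 (hg Aᶜ)).1
        linarith

variable {X Y : Type*} [Fintype X] [Fintype Y]

/-- The cut norm controls the `∞ → 1` norm. -/
theorem abs_sum_sum_le_of_cut {a : X → Y → ℝ} {D : ℝ}
    (ha : ∀ (A : Set X) (B : Set Y),
      |∑ x, A.indicator (fun x => ∑ y, B.indicator (a x) y) x| ≤ D)
    {s : X → ℝ} {t : Y → ℝ} (hs : ∀ x, |s x| ≤ 1) (ht : ∀ y, |t y| ≤ 1) :
    |∑ x, ∑ y, a x y * (s x * t y)| ≤ 4 * D := by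
  classical
  have h1 : ∀ B : Set Y, |∑ y, B.indicator (fun y => ∑ x, s x * a x y) y| ≤ 2 * D := by
    intro B
    have := abs_sum_mul_le_of_indicator (s := s) (fun A => ha A B) hs
    convert this using 2
    simp only [Set.indicator_apply, ← sum_filter, mul_sum]
    exact sum_comm
  have h2 := abs_sum_mul_le_of_indicator h1 ht
  have e : ∑ y, t y * ∑ x, s x * a x y = ∑ x, ∑ y, a x y * (s x * t y) := by
    simp only [mul_sum]
    rw [sum_comm]
    exact sum_congr rfl fun x _ => sum_congr rfl fun y _ => by ring
  rw [e] at h2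
  linarith

/-- `K` bounds the bilinear form of `a` on finite families of vectors in the unit ball. -/
def GrothendieckBound (a : X → Y → ℝ) (K : ℝ) : Prop :=
  ∀ (d : ℕ) (u : X → Fin d → ℝ) (v : Y → Fin d → ℝ),
    (∀ x, ∑ i, u x i ^ 2 ≤ 1) → (∀ y, ∑ i, v y i ^ 2 ≤ 1) →
      |∑ x, ∑ y, a x y * ∑ i, u x i * v y i| ≤ K

theorem GrothendieckBound.of_fintype {a : X → Y → ℝ} {K : ℝ} (h : GrothendieckBound a K)
    {ι : Type*} [Fintype ι] (u : X → ι → ℝ) (v : Y → ι → ℝ)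
    (hu : ∀ x, ∑ i, u x i ^ 2 ≤ 1) (hv : ∀ y, ∑ i, v y i ^ 2 ≤ 1) :
    |∑ x, ∑ y, a x y * ∑ i, u x i * v y i| ≤ K := by
  let e := (Fintype.equivFin ι).symm
  have := h _ (fun x i => u x (e i)) (fun y i => v y (e i))
    (fun x => by rw [e.sum_comp (fun i => u x i ^ 2)]; exact hu x)
    (fun y => by rw [e.sum_comp (fun i => v y i ^ 2)]; exact hv y)
  simpa only [fun x y => e.sum_comp (fun i => u x i * v y i)] using this

/-- Cauchy–Schwarz on each entry; this crude finite bound starts the iteration. -/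
theorem grothendieckBound_sum_abs (a : X → Y → ℝ) :
    GrothendieckBound a (∑ x, ∑ y, |a x y|) := by
  intro d u v hu hv
  refine (abs_sum_le_sum_abs _ _).trans (sum_le_sum fun x _ => ?_)
  refine (abs_sum_le_sum_abs _ _).trans (sum_le_sum fun y _ => ?_)
  rw [abs_mul]
  refine mul_le_of_le_one_right (abs_nonneg _) ?_
  rw [← sq_le_one_iff_abs_le_one]
  refine (sum_mul_sq_le_sq_mul_sq univ (u x) (v y)).trans ?_
  exact mul_le_one₀ (hu x) (sum_nonneg fun i _ => sq_nonneg _) (hv y)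

/-- Replace vectors by their Rademacher sums and truncate. The bounded parts are handled pointwise
by the cut norm; the tails have small L² norm, so the old bound `K` applies to them with a gain. -/
theorem GrothendieckBound.improve {a : X → Y → ℝ} {D K : ℝ} (hK : GrothendieckBound a K)
    (ha : ∀ (A : Set X) (B : Set Y),
      |∑ x, A.indicator (fun x => ∑ y, B.indicator (a x) y) x| ≤ D) :
    GrothendieckBound a (192 * D + K / 2) := by
  intro d u v hu hv
  obtain ⟨Ω, _, r, hN, h2, h4⟩ := exists_rademacher d
  set N : ℝ := ((Fintype.card Ω : ℕ) : ℝ) with hNdef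
  have hN0 : 0 < N := Nat.cast_pos.2 hN
  -- With this scaling `w ↦ c * r w` is an isometry into `ℝ^Ω`.
  set c : ℝ := (√N)⁻¹ with hc
  have hcN : c ^ 2 * N = 1 := by
    rw [hc, inv_pow, Real.sq_sqrt hN0.le, inv_mul_cancel₀ hN0.ne']
  set lo : ℝ → ℝ := fun z => if z ^ 2 ≤ 48 then z else 0 with hlo
  set hi : ℝ → ℝ := fun z => if z ^ 2 ≤ 48 then 0 else z with hhi
  have split : ∀ z, z = lo z + hi z := fun z => by simp only [hlo, hhi]; split_ifs <;> simp
  have lo_sq : ∀ z, lo z ^ 2 ≤ z ^ 2 := fun z => by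
    simp only [hlo]; split_ifs <;> nlinarith [sq_nonneg z]
  have lo_sq' : ∀ z, lo z ^ 2 ≤ 48 := fun z => by
    simp only [hlo]; split_ifs with h <;> [exact h; norm_num]
  have hi_sq : ∀ z, 48 * hi z ^ 2 ≤ z ^ 4 := fun z => by
    simp only [hhi]; split_ifs <;> nlinarith [sq_nonneg (z ^ 2)]
  have full : ∀ w : Fin d → ℝ, ∑ i, w i ^ 2 ≤ 1 → ∑ ω, (c * r w ω) ^ 2 ≤ 1 := by
    intro w hw
    have e : ∑ ω, (c * r w ω) ^ 2 = c ^ 2 * ∑ ω, r w ω * r w ω := by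
      rw [mul_sum]; exact sum_congr rfl fun ω _ => by ring
    rw [e, h2, ← mul_assoc, hcN, one_mul]
    simpa only [pow_two] using hw
  have low : ∀ w : Fin d → ℝ, ∑ i, w i ^ 2 ≤ 1 → ∑ ω, (c * lo (r w ω)) ^ 2 ≤ 1 := by
    intro w hw
    refine (sum_le_sum fun ω _ => ?_).trans (full w hw)
    rw [mul_pow, mul_pow]
    exact mul_le_mul_of_nonneg_left (lo_sq _) (sq_nonneg _)
  -- The threshold 48 makes the squared L² norm of a tail at most 3/48 = 1/16.
  have high : ∀ w : Fin d → ℝ, ∑ i, w i ^ 2 ≤ 1 → ∑ ω, (4 * (c * hi (r w ω))) ^ 2 ≤ 1 := by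
    intro w hw
    have hw0 : 0 ≤ ∑ i, w i ^ 2 := sum_nonneg fun i _ => sq_nonneg _
    calc ∑ ω, (4 * (c * hi (r w ω))) ^ 2 ≤ ∑ ω, c ^ 2 * (r w ω ^ 4 / 3) := by
          refine sum_le_sum fun ω _ => ?_
          have := mul_le_mul_of_nonneg_left (hi_sq (r w ω)) (sq_nonneg c)
          nlinarith
      _ = c ^ 2 * ((∑ ω, r w ω ^ 4) / 3) := by rw [← mul_sum, sum_div]
      _ ≤ c ^ 2 * (N * (∑ i, w i ^ 2) ^ 2) := by
          refine mul_le_mul_of_nonneg_left ?_ (sq_nonneg c)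
          have := h4 w
          linarith
      _ = (∑ i, w i ^ 2) ^ 2 := by rw [← mul_assoc, hcN, one_mul]
      _ ≤ 1 := pow_le_one₀ hw0 hw
  -- Expands `r r'` as `lo lo' + lo hi' + hi r'`; each of the last two terms costs `K / 4`.
  have key : ∀ x y, a x y * ∑ i, u x i * v y i =
      c ^ 2 * 48 * ∑ ω, a x y * (lo (r (u x) ω) / √48 * (lo (r (v y) ω) / √48)) +
      1 / 4 * (a x y * ∑ ω, c * lo (r (u x) ω) * (4 * (c * hi (r (v y) ω)))) +
      1 / 4 * (a x y * ∑ ω, 4 * (c * hi (r (u x) ω)) * (c * r (v y) ω)) := by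
    intro x y
    have e : ∑ i, u x i * v y i = c ^ 2 * ∑ ω, r (u x) ω * r (v y) ω := by
      rw [h2, ← mul_assoc, hcN, one_mul]
    rw [e]
    simp only [mul_sum, ← sum_add_distrib]
    refine sum_congr rfl fun ω _ => ?_
    have h48 : lo (r (u x) ω) / √48 * (lo (r (v y) ω) / √48)
        = lo (r (u x) ω) * lo (r (v y) ω) / 48 := by
      rw [div_mul_div_comm, Real.mul_self_sqrt (by norm_num)]
    rw [h48]
    have s1 := split (r (u x) ω)
    have s2 := split (r (v y) ω)
    generalize lo (r (u x) ω) = p at *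
    generalize hi (r (u x) ω) = q at *
    generalize lo (r (v y) ω) = p' at *
    generalize hi (r (v y) ω) = q' at *
    rw [s1, s2]
    ring
  have b1 : |∑ x, ∑ y, ∑ ω, a x y * (lo (r (u x) ω) / √48 * (lo (r (v y) ω) / √48))|
      ≤ N * (4 * D) := by
    have e : ∑ x, ∑ y, ∑ ω, a x y * (lo (r (u x) ω) / √48 * (lo (r (v y) ω) / √48)) =
        ∑ ω, ∑ x, ∑ y, a x y * (lo (r (u x) ω) / √48 * (lo (r (v y) ω) / √48)) := by
      rw [sum_comm (s := (univ : Finset Ω))]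
      exact sum_congr rfl fun x _ => sum_comm
    have bd : ∀ z, |lo z / √48| ≤ 1 := fun z => by
      rw [← sq_le_one_iff_abs_le_one, div_pow, Real.sq_sqrt (by norm_num)]
      have := lo_sq' z
      linarith
    rw [e]
    refine (abs_sum_le_sum_abs _ _).trans ?_
    refine (sum_le_card_nsmul _ _ (4 * D) fun ω _ =>
      abs_sum_sum_le_of_cut ha (fun x => bd _) (fun y => bd _)).trans ?_
    simp [hNdef]
  have b2 := hK.of_fintype _ _ (fun x => low (u x) (hu x)) (fun y => high (v y) (hv y))
  have b3 := hK.of_fintype _ _ (fun x => high (u x) (hu x)) (fun y => full (v y) (hv y))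
  simp only [key, sum_add_distrib, ← mul_sum]
  simp only [← mul_sum] at b1
  have b1' : |c ^ 2 * 48 * ∑ x, ∑ y, a x y *
      ∑ ω, lo (r (u x) ω) / √48 * (lo (r (v y) ω) / √48)| ≤ 192 * D := by
    rw [abs_mul, abs_of_nonneg (by positivity : 0 ≤ c ^ 2 * 48)]
    refine (mul_le_mul_of_nonneg_left b1 (by positivity)).trans (le_of_eq ?_)
    linear_combination 192 * D * hcN
  refine (abs_add_three _ _ _).trans ?_
  rw [abs_mul (1 / 4 : ℝ), abs_mul (1 / 4 : ℝ), abs_of_pos (by norm_num : (0 : ℝ) < 1 / 4)]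
  linarith

/-- **Grothendieck's inequality**, with the cut norm and a non-optimal constant. -/
theorem grothendieckBound_of_cut {a : X → Y → ℝ} {D : ℝ}
    (ha : ∀ (A : Set X) (B : Set Y),
      |∑ x, A.indicator (fun x => ∑ y, B.indicator (a x) y) x| ≤ D) :
    GrothendieckBound a (384 * D) := by
  set S := ∑ x, ∑ y, |a x y| with hS
  have hD : 0 ≤ D := (abs_nonneg _).trans (ha ∅ ∅)
  -- 384 * D is the fixed point of `K ↦ 192 * D + K / 2`.
  have h : ∀ k : ℕ, GrothendieckBound a (384 * D + S * (1 / 2) ^ k) := by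
    intro k
    induction k with
    | zero =>
      intro d u v hu hv
      have := grothendieckBound_sum_abs a d u v hu hv
      simp only [pow_zero, mul_one]
      linarith
    | succ k ih =>
      have := ih.improve ha
      convert this using 1
      ring
  intro d u v hu hv
  have lim : Filter.Tendsto (fun k : ℕ => 384 * D + S * (1 / 2 : ℝ) ^ k) Filter.atTop
      (nhds (384 * D + S * 0)) :=
    ((tendsto_pow_atTop_nhds_zero_of_lt_one (by norm_num) (by norm_num)).const_mul S).const_add _
  rw [mul_zero, add_zero] at lim
  exact ge_of_tendsto' lim fun k => h k d u v hu hv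

end Grothendieck

/-! ### Rigidity of the vector constraints -/

section Constraints

variable {d : ℕ} {u u0 u1 : EuclideanSpace ℝ (Fin d)}

/-- Expanding `‖u0 + u1 - u‖ ^ 2` with the constraints gives 0. -/
theorem SpeakerConstraints.add_eq (h : SpeakerConstraints u u0 u1) : u0 + u1 = u := by
  obtain ⟨h1, h2, h3⟩ := h
  rw [← sub_eq_zero, ← norm_eq_zero, ← sq_eq_zero_iff, norm_sub_sq_real, norm_add_sq_real,
    inner_add_left, h3, h2]
  linarith

theorem SpeakerConstraints.norm_le (h : SpeakerConstraints u u0 u1) (hu : ‖u‖ ≤ 1) :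
    ‖u0‖ ≤ 1 ∧ ‖u1‖ ≤ 1 := by
  have h1 := h.1
  constructor <;> nlinarith [norm_nonneg u, norm_nonneg u0, norm_nonneg u1]

theorem ListenerConstraints.eq (h : ListenerConstraints u u0 u1) : u0 = u ∧ u1 = u := by
  obtain ⟨h1, h2, h3, h4⟩ := h
  constructor
  · rw [← sub_eq_zero, ← norm_eq_zero, ← sq_eq_zero_iff, norm_sub_sq_real, h1, h3]
    ring
  · rw [← sub_eq_zero, ← norm_eq_zero, ← sq_eq_zero_iff, norm_sub_sq_real, h2, h4]
    ring

end Constraints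

theorem ProtocolStructure.subtree_append (T : ProtocolStructure) (s t : List Bool) :
    T.subtree (s ++ t) = (T.subtree s).bind fun S => S.subtree t := by
  induction s generalizing T with
  | nil => simp [subtree]
  | cons b s ih =>
    cases T with
    | leaf => cases b <;> simp [subtree]
    | node P T0 T1 => cases b <;> simp [subtree, ih]

theorem grothendieckBound_inner {X Y : Type*} [Fintype X] [Fintype Y] {a : X → Y → ℝ} {K : ℝ}
    (h : GrothendieckBound a K) {d : ℕ} (u : X → EuclideanSpace ℝ (Fin d))
    (v : Y → EuclideanSpace ℝ (Fin d)) (hu : ∀ x, ‖u x‖ ≤ 1) (hv : ∀ y, ‖v y‖ ≤ 1) :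
    |∑ x, ∑ y, a x y * inner ℝ (u x) (v y)| ≤ K := by
  have key : ∀ w : EuclideanSpace ℝ (Fin d), ‖w‖ ≤ 1 → ∑ i, w i ^ 2 ≤ 1 := fun w hw => by
    rw [← EuclideanSpace.real_norm_sq_eq]
    exact pow_le_one₀ (norm_nonneg _) hw
  have := h d (fun x i => u x i) (fun y i => v y i) (fun x => key _ (hu x)) (fun y => key _ (hv y))
  simpa [PiLp.inner_apply, mul_comm] using this

/-! ### Lower bound on depth by discrepancy -/

section LowerBound

variable {X Y : Type*} [Fintype X] [Fintype Y]

/-- The entry of the sign matrix of `f`. -/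
def boolSign (b : Bool) : ℝ := if b then -1 else 1

/-- Induction on the subtree: inner products add over children, and each leaf contributes at most
`K`. -/
theorem Gamma2Protocol.sum_inner_le (π : Gamma2Protocol X Y) {f : X → Y → Bool}
    (hπ : π.Computes (boolRelation f)) {m : X → Y → ℝ} {K : ℝ}
    (hK : GrothendieckBound (fun x y => m x y * boolSign (f x y)) K)
    (S : ProtocolStructure) :
    ∀ t, π.T.subtree t = some S → (∀ x, ‖π.α t x‖ ≤ 1) → (∀ y, ‖π.β t y‖ ≤ 1) →
      ∑ x, ∑ y, m x y * inner ℝ (π.α t x) (π.β t y) ≤ 2 ^ S.depth * K := by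
  have hK0 : 0 ≤ K := (abs_nonneg _).trans (hK 0 (fun _ _ => 0) (fun _ _ => 0) (by simp) (by simp))
  induction S with
  | leaf =>
    intro t ht hα hβ
    have hlen := hπ.1 t ht
    obtain ⟨s, z, rfl⟩ : ∃ s z, t = s ++ [z] :=
      ⟨t.dropLast, t.getLast (List.ne_nil_of_length_pos hlen),
        (List.dropLast_append_getLast _).symm⟩
    have hz := hπ.2 s (fun _ => z) (by simpa [ProtocolStructure.IsLeaf] using ht)
    simp only [List.ofFn_succ, List.ofFn_zero, boolRelation] at hz
    -- Where `f x y = z` the two signs multiply to 1; elsewhere the inner product vanishes.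
    have e : ∑ x, ∑ y, m x y * inner ℝ (π.α (s ++ [z]) x) (π.β (s ++ [z]) y) =
        boolSign z * ∑ x, ∑ y, m x y * boolSign (f x y) *
          inner ℝ (π.α (s ++ [z]) x) (π.β (s ++ [z]) y) := by
      simp only [mul_sum]
      refine sum_congr rfl fun x _ => sum_congr rfl fun y _ => ?_
      by_cases h : f x y = z
      · rw [h]
        cases z <;> simp [boolSign]
      · rw [hz x y h]
        ring
    have hb := grothendieckBound_inner hK _ _ hα hβ
    rw [e]
    refine (le_abs_self _).trans ?_
    rw [abs_mul]
    have : |boolSign z| = 1 := by cases z <;> simp [boolSign]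
    simpa [this, ProtocolStructure.depth] using hb
  | node P T0 T1 ih0 ih1 =>
    intro t ht hα hβ
    have ht0 : π.T.subtree (t ++ [false]) = some T0 := by
      rw [ProtocolStructure.subtree_append, ht]; simp [ProtocolStructure.subtree]
    have ht1 : π.T.subtree (t ++ [true]) = some T1 := by
      rw [ProtocolStructure.subtree_append, ht]; simp [ProtocolStructure.subtree]
    have main : ((∀ x, ‖π.α (t ++ [false]) x‖ ≤ 1) ∧ (∀ y, ‖π.β (t ++ [false]) y‖ ≤ 1)) ∧
        ((∀ x, ‖π.α (t ++ [true]) x‖ ≤ 1) ∧ (∀ y, ‖π.β (t ++ [true]) y‖ ≤ 1)) ∧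
        ∀ x y, inner ℝ (π.α t x) (π.β t y) =
          inner ℝ (π.α (t ++ [false]) x) (π.β (t ++ [false]) y) +
          inner ℝ (π.α (t ++ [true]) x) (π.β (t ++ [true]) y) := by
      cases P with
      | alice =>
        obtain ⟨hs, hl⟩ := π.alice_node t ⟨T0, T1, ht⟩
        refine ⟨⟨fun x => ((hs x).norm_le (hα x)).1, fun y => by rw [(hl y).eq.1]; exact hβ y⟩,
          ⟨fun x => ((hs x).norm_le (hα x)).2, fun y => by rw [(hl y).eq.2]; exact hβ y⟩,
          fun x y => ?_⟩
        rw [(hl y).eq.1, (hl y).eq.2, ← inner_add_left, (hs x).add_eq]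
      | bob =>
        obtain ⟨hs, hl⟩ := π.bob_node t ⟨T0, T1, ht⟩
        refine ⟨⟨fun x => by rw [(hl x).eq.1]; exact hα x, fun y => ((hs y).norm_le (hβ y)).1⟩,
          ⟨fun x => by rw [(hl x).eq.2]; exact hα x, fun y => ((hs y).norm_le (hβ y)).2⟩,
          fun x y => ?_⟩
        rw [(hl x).eq.1, (hl x).eq.2, ← inner_add_right, (hs y).add_eq]
    obtain ⟨⟨a0, b0⟩, ⟨a1, b1⟩, hsum⟩ := main
    have i0 := ih0 _ ht0 a0 b0
    have i1 := ih1 _ ht1 a1 b1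
    simp only [hsum, mul_add, sum_add_distrib]
    have p0 : (2 : ℝ) ^ T0.depth * K ≤ 2 ^ max T0.depth T1.depth * K :=
      mul_le_mul_of_nonneg_right (pow_le_pow_right₀ one_le_two (le_max_left _ _)) hK0
    have p1 : (2 : ℝ) ^ T1.depth * K ≤ 2 ^ max T0.depth T1.depth * K :=
      mul_le_mul_of_nonneg_right (pow_le_pow_right₀ one_le_two (le_max_right _ _)) hK0
    rw [ProtocolStructure.depth, pow_succ]
    linarith

theorem discRect_eq (μ : stdSimplex ℝ (X × Y)) (A : Set X) (B : Set Y) (f : X → Y → Bool) :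
    discRect μ A B f = |∑ x, A.indicator (fun x => ∑ y, B.indicator
      (fun y => (μ : X × Y → ℝ) (x, y) * boolSign (f x y)) y) x| := by
  classical
  unfold discRect prob
  rw [← sum_sub_distrib, Fintype.sum_prod_type]
  congr 1
  refine sum_congr rfl fun x _ => ?_
  by_cases hx : x ∈ A
  · rw [Set.indicator_of_mem hx]
    refine sum_congr rfl fun y _ => ?_
    by_cases hy : y ∈ B <;> cases h : f x y <;> simp [Set.indicator, hx, hy, h, boolSign]
  · simp [Set.indicator, hx]

theorem discRect_le_discUnder (μ : stdSimplex ℝ (X × Y)) (A : Set X) (B : Set Y)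
    (f : X → Y → Bool) : discRect μ A B f ≤ discUnder μ f :=
  le_ciSup (f := fun R : Set X × Set Y => discRect μ R.1 R.2 f) (Set.finite_range _).bddAbove
    (A, B)

theorem Gamma2Protocol.one_le_discUnder (π : Gamma2Protocol X Y) {f : X → Y → Bool}
    (hπ : π.Computes (boolRelation f)) (μ : stdSimplex ℝ (X × Y)) :
    1 ≤ 2 ^ π.T.depth * (384 * discUnder μ f) := by
  have hK : GrothendieckBound (fun x y => (μ : X × Y → ℝ) (x, y) * boolSign (f x y))
      (384 * discUnder μ f) := grothendieckBound_of_cut fun A B => by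
    rw [← discRect_eq]
    exact discRect_le_discUnder μ A B f
  have h := π.sum_inner_le hπ (m := fun x y => (μ : X × Y → ℝ) (x, y)) hK π.T []
    (by simp [ProtocolStructure.subtree])
    (fun x => ?_) (fun y => ?_)
  · simp only [π.root_both, mul_one] at h
    have hμ : ∑ p, (μ : X × Y → ℝ) p = 1 := μ.2.2
    rwa [← Fintype.sum_prod_type (fun p : X × Y => (μ : X × Y → ℝ) p), hμ] at h
  · rw [← sq_le_one_iff₀ (norm_nonneg _), ← real_inner_self_eq_norm_sq, π.root_alice]
  · rw [← sq_le_one_iff₀ (norm_nonneg _), ← real_inner_self_eq_norm_sq, π.root_bob]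

theorem Gamma2Protocol.one_le_disc [Nonempty X] [Nonempty Y] (π : Gamma2Protocol X Y)
    {f : X → Y → Bool} (hπ : π.Computes (boolRelation f)) :
    1 ≤ 2 ^ π.T.depth * (384 * disc f) := by
  have hpos : (0 : ℝ) < 2 ^ π.T.depth * 384 := by positivity
  have : 1 / (2 ^ π.T.depth * 384) ≤ disc f := le_ciInf fun μ => by
    rw [div_le_iff₀ hpos]
    linarith [π.one_le_discUnder hπ μ]
  rw [div_le_iff₀ hpos] at this
  linarith

end LowerBound

/-! ### Existence of a protocol computing `f` -/

section Existence

variable {X Y : Type*}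

/-- Alice announces her input by answering equality queries along the list, then Bob announces
the value of `f`. -/
def queryTree : List X → ProtocolStructure
  | [] => .leaf
  | _ :: L => .node .alice (queryTree L) (.node .bob .leaf .leaf)

/-- The set of inputs of Alice that are consistent with a node of `queryTree L`. -/
def queryAlice : List X → List Bool → X → Prop
  | _, [], _ => True
  | [], _ :: _, _ => False
  | x₀ :: L, false :: t, x => x ≠ x₀ ∧ queryAlice L t x
  | x₀ :: _, true :: _, x => x = x₀

/-- The set of inputs of Bob that are consistent with a node of `queryTree L`. -/
def queryBob (f : X → Y → Bool) : List X → List Bool → Y → Prop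
  | _ :: L, false :: t, y => queryBob f L t y
  | x₀ :: _, [true, b], y => f x₀ y = b
  | _, _, _ => True

theorem queryTree_alice (f : X → Y → Bool) (L : List X) (t : List Bool)
    (h : (queryTree L).IsNodeOf .alice t) :
    (∀ x, (queryAlice L (t ++ [false]) x ∨ queryAlice L (t ++ [true]) x ↔ queryAlice L t x) ∧
      ¬ (queryAlice L (t ++ [false]) x ∧ queryAlice L (t ++ [true]) x)) ∧
    ∀ y b, queryBob f L (t ++ [b]) y ↔ queryBob f L t y := by
  induction L generalizing t with
  | nil => cases t <;> simp [ProtocolStructure.IsNodeOf, queryTree, ProtocolStructure.subtree] at h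
  | cons x₀ L ih =>
    match t with
    | [] =>
      refine ⟨fun x => ?_, fun y b => ?_⟩
      · cases L <;> simp [queryAlice] <;> tauto
      · cases L <;> cases b <;> simp [queryBob]
    | false :: t =>
      have := ih t h
      refine ⟨fun x => ?_, fun y b => this.2 y b⟩
      have := this.1 x
      simp only [List.cons_append, queryAlice]
      tauto
    | [true] =>
      simp [ProtocolStructure.IsNodeOf, queryTree, ProtocolStructure.subtree] at h
    | true :: b :: t =>
      cases t <;> cases b <;>
        simp [ProtocolStructure.IsNodeOf, queryTree, ProtocolStructure.subtree] at h

theorem queryTree_bob (f : X → Y → Bool) (L : List X) (t : List Bool)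
    (h : (queryTree L).IsNodeOf .bob t) :
    (∀ y, (queryBob f L (t ++ [false]) y ∨ queryBob f L (t ++ [true]) y ↔ queryBob f L t y) ∧
      ¬ (queryBob f L (t ++ [false]) y ∧ queryBob f L (t ++ [true]) y)) ∧
    ∀ x b, queryAlice L (t ++ [b]) x ↔ queryAlice L t x := by
  induction L generalizing t with
  | nil => cases t <;> simp [ProtocolStructure.IsNodeOf, queryTree, ProtocolStructure.subtree] at h
  | cons x₀ L ih =>
    match t with
    | [] =>
      simp [ProtocolStructure.IsNodeOf, queryTree, ProtocolStructure.subtree] at h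
    | false :: t =>
      have := ih t h
      refine ⟨fun y => this.1 y, fun x b => ?_⟩
      have := this.2 x b
      simp only [List.cons_append, queryAlice]
      tauto
    | [true] =>
      refine ⟨fun y => ?_, fun x b => ?_⟩
      · cases h : f x₀ y <;> simp [queryBob, h]
      · simp [queryAlice]
    | true :: b :: t =>
      cases t <;> cases b <;>
        simp [ProtocolStructure.IsNodeOf, queryTree, ProtocolStructure.subtree] at h

theorem queryTree_leaf (f : X → Y → Bool) (L : List X) (t : List Bool) (z : Bool)
    (h : (queryTree L).IsLeaf (t ++ [z])) {x : X} {y : Y} (hx : x ∈ L)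
    (hα : queryAlice L (t ++ [z]) x) (hβ : queryBob f L (t ++ [z]) y) : f x y = z := by
  induction L generalizing t with
  | nil => simp at hx
  | cons x₀ L ih =>
    match t with
    | [] =>
      cases z
      -- The all-`false` leaf is inconsistent: every listed input has been excluded.
      · cases L with
        | nil =>
          simp [queryAlice] at hα hx
          exact absurd hx hα
        | cons x₁ L =>
          simp [ProtocolStructure.IsLeaf, queryTree, ProtocolStructure.subtree] at h
      · simp [ProtocolStructure.IsLeaf, queryTree, ProtocolStructure.subtree] at h
    | false :: t =>
      refine ih t h ?_ hα.2 hβ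
      exact (List.mem_cons.1 hx).resolve_left hα.1
    | [true] =>
      change x = x₀ at hα
      subst hα
      exact hβ
    | true :: b :: t =>
      cases t <;> cases b <;>
        simp [ProtocolStructure.IsLeaf, queryTree, ProtocolStructure.subtree] at h

open Classical in
/-- The one-dimensional indicator vector of a proposition. -/
noncomputable def indVec (p : Prop) : EuclideanSpace ℝ (Fin 1) :=
  EuclideanSpace.single 0 (if p then 1 else 0)

theorem indVec_inner (p q : Prop) [Decidable (p ∧ q)] :
    inner ℝ (indVec p) (indVec q) = if p ∧ q then 1 else 0 := by
  by_cases hp : p <;> by_cases hq : q <;> simp [indVec, PiLp.inner_apply, hp, hq]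

theorem indVec_norm_sq (p : Prop) [Decidable p] : ‖indVec p‖ ^ 2 = if p then 1 else 0 := by
  by_cases hp : p <;> simp [indVec, hp]

@[simp]
theorem norm_indVec_true : ‖indVec True‖ = 1 := by simp [indVec]

theorem indVec_speaker {p p0 p1 : Prop} (h : p0 ∨ p1 ↔ p) (h' : ¬ (p0 ∧ p1)) :
    SpeakerConstraints (indVec p) (indVec p0) (indVec p1) := by
  classical
  by_cases h0 : p0 <;> by_cases h1 : p1 <;>
    simp [SpeakerConstraints, indVec_inner, indVec_norm_sq, ← h, h0, h1] at h' ⊢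

theorem indVec_listener (p : Prop) : ListenerConstraints (indVec p) (indVec p) (indVec p) := by
  simp [ListenerConstraints]

/-- The deterministic protocol in which Alice announces her input, as a `γ₂` protocol. -/
noncomputable def queryProtocol (f : X → Y → Bool) (L : List X) : Gamma2Protocol X Y where
  T := queryTree L
  d := 1
  α t x := indVec (queryAlice L t x)
  β t y := indVec (queryBob f L t y)
  root_alice x x' := by cases L <;> simp [queryAlice]
  root_bob y y' := by cases L <;> simp [queryBob]
  root_both x y := by cases L <;> simp [queryAlice, queryBob]
  alice_node t ht := by
    obtain ⟨h1, h2⟩ := queryTree_alice f L t ht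
    refine ⟨fun x => indVec_speaker (h1 x).1 (h1 x).2, fun y => ?_⟩
    simp only [h2]
    exact indVec_listener _
  bob_node t ht := by
    obtain ⟨h1, h2⟩ := queryTree_bob f L t ht
    refine ⟨fun y => indVec_speaker (h1 y).1 (h1 y).2, fun x => ?_⟩
    simp only [h2]
    exact indVec_listener _

/-- Needed because `sInf ∅ = 0` in `ℕ`: without a protocol the minimum would not be attained. -/
theorem exists_computes [Finite X] [Nonempty X] (f : X → Y → Bool) :
    ∃ π : Gamma2Protocol X Y, π.Computes (boolRelation f) := by
  classical
  cases nonempty_fintype X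
  have hmem : ∀ x : X, x ∈ (univ : Finset X).toList := by simp
  refine ⟨queryProtocol f univ.toList, fun l hl => ?_, fun t z hl x y hxy => ?_⟩
  · cases l with
    | nil =>
      have x : X := Classical.arbitrary X
      have hx := hmem x
      change (queryTree univ.toList).subtree [] = some .leaf at hl
      cases h : (univ : Finset X).toList with
      | nil => simp [h] at hx
      | cons x₀ L => simp [h, queryTree, ProtocolStructure.subtree] at hl
    | cons b l => simp
  · simp only [List.ofFn_succ, List.ofFn_zero] at hl ⊢
    change inner ℝ (indVec _) (indVec _) = (0 : ℝ)
    rw [indVec_inner, if_neg]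
    rintro ⟨h1, h2⟩
    exact hxy (queryTree_leaf f _ t _ hl (hmem x) h1 h2)

end Existence

end GammaTwo

theorem mainTheorem5 :
    ∃ C : ℝ, ∀ (X Y : Type*) [Fintype X] [Fintype Y] [Nonempty X] [Nonempty Y]
      (f : X → Y → Bool),
      Real.logb 2 (1 / GammaTwo.disc f) - C ≤
        (GammaTwo.gamma2Dcc (GammaTwo.boolRelation f) : ℝ) := by
  refine ⟨Real.logb 2 384, fun X Y _ _ _ _ f => ?_⟩
  obtain ⟨π₀, h₀⟩ := GammaTwo.exists_computes f
  obtain ⟨π, hπ, hd⟩ := Nat.sInf_mem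
    (⟨_, π₀, h₀, rfl⟩ : {n | ∃ π : GammaTwo.Gamma2Protocol X Y,
      π.Computes (GammaTwo.boolRelation f) ∧ π.T.depth = n}.Nonempty)
  have h := π.one_le_disc hπ
  rw [hd] at h
  change 1 ≤ 2 ^ GammaTwo.gamma2Dcc (GammaTwo.boolRelation f) * _ at h
  generalize GammaTwo.gamma2Dcc (GammaTwo.boolRelation f) = n at h ⊢
  -- The inequality `h` itself excludes zero discrepancy, so the logarithm is genuine.
  have hpos : 0 < GammaTwo.disc f := by
    by_contra hneg
    have : (2 : ℝ) ^ n * (384 * GammaTwo.disc f) ≤ 0 :=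
      mul_nonpos_of_nonneg_of_nonpos (by positivity) (by linarith)
    linarith
  have h' : 1 / GammaTwo.disc f ≤ 2 ^ n * 384 := by
    rw [div_le_iff₀ hpos]
    linarith
  have := Real.logb_le_logb_of_le one_lt_two (by positivity) h'
  rw [Real.logb_mul (by positivity) (by norm_num), Real.logb_pow, Real.logb_self_eq_one one_lt_two]
    at this
  linarith
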